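/- For a commutative ring $R$ and a positive integer $n$ put $\Sigma^n R^2=\{x_1^2+\cdots+x_n^2 : x_1,\ldots,x_n\in R\}$, and let the Pythagoras number of $R$ be $$P(R)=\inf\{n\in\mathbb{Z}_{\ge 1} : \Sigma^n R^2=\Sigma^{n+1}R^2\}\in\mathbb{Z}_{\ge 1}\cup\{\infty\},$$ where $\inf\emptyset=\infty$. For an algebraic extension $K/\mathbb{Q}$ let $\mathcal{O}_K$ be its ring of integers, i.e. the integral closure of $\mathbb{Z}$ in $K$. Theorem. Let $S\subseteq\mathbb{N}$ be a set that contains infinitely many prime numbers $p\equiv 1\pmod 4$, and let $K=\mathbb{Q}(\sqrt{n} : n\in S)\subseteq\mathbb{R}$. Then $P(\mathcal{O}_K)=\infty$. In particular, if $K$ is the compositum in $\mathbb{R}$ of all real quadratic fields, then $P(\mathcal{O}_K)=\infty$. -/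

import Mathlib

/-- The set of sums of `n` squares `x₁² + ⋯ + xₙ²` of elements of `R`. -/
def sumsOfSquares (R : Type*) [CommRing R] (n : ℕ) : Set R :=
  {a | ∃ x : Fin n → R, a = ∑ i, x i ^ 2}

/-- The Pythagoras number of `R`: the infimum in `ℕ ∪ {∞}` of the positive integers `n` such that
every sum of `n + 1` squares is a sum of `n` squares (and conversely); it is `⊤` if there is
no such `n`. -/
noncomputable def pythagorasNumber (R : Type*) [CommRing R] : ℕ∞ :=
  ⨅ (n : ℕ) (_ : 1 ≤ n ∧ sumsOfSquares R n = sumsOfSquares R (n + 1)), (n : ℕ∞)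

/-- The field `ℚ(√n : n ∈ S)`, as a subfield of `ℝ`. -/
noncomputable def realMultiquadraticField (S : Set ℕ) : IntermediateField ℚ ℝ :=
  IntermediateField.adjoin ℚ ((fun n : ℕ => √(n : ℝ)) '' S)

/-- The compositum inside `ℝ` of all real quadratic fields, that is, of all subfields of `ℝ`
of degree two over `ℚ`. -/
noncomputable def compositumRealQuadratic : IntermediateField ℚ ℝ :=
  ⨆ (F : IntermediateField ℚ ℝ) (_ : Module.finrank ℚ F = 2), F

open IntermediateField

/-! Put ω_q = (1 + √q)/2 and work in the totally real Galois field L generated by all √q, q prime.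
For primes growing fast enough, the sum of n squares ω_q² is not a sum of fewer than n squares of
integers of L. Suppose ∑ Y_j² = ω_p² + β, where β collects the smaller primes. Write Y_j = a_j +
b_j√p and average with the conjugate under √p ↦ -√p: p∑(2b_j)² + ∑(2a_j)² = 1 + p + 4β. As p
dominates the conjugates of 4β, every conjugate of ∑(2b_j)² is below 2. Each 2b_j is integral
because p is odd and unramified in the field of the a_j, b_j (`isIntegral_of_prime_mul_sq`), so 2b_j
is 0 or ±1 and exactly one is nonzero. The √p-coefficient then forces that Y_i to be ±ω_p
(`exists_sq_eq_of_sum_sq_eq`); cancel it and induct. -/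

/-! ### Integers with small conjugates, and a denominator bound over ℚ. -/

theorem Multiset.abs_prod_lt_one {s : Multiset ℝ} (h : ∀ x ∈ s, |x| < 1) (hs : s ≠ 0) :
    |s.prod| < 1 := by
  induction s using Multiset.induction_on with
  | empty => exact absurd rfl hs
  | cons a t ih =>
    rw [Multiset.prod_cons, abs_mul]
    have ha : |a| < 1 := h a (Multiset.mem_cons_self a t)
    rcases eq_or_ne t 0 with rfl | ht
    · simpa using ha
    · have := ih (fun x hx => h x (Multiset.mem_cons_of_mem hx)) ht
      nlinarith [abs_nonneg a, abs_nonneg t.prod]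

/-- An algebraic integer of a real Galois extension of `ℚ` all of whose conjugates have absolute
value less than one vanishes. -/
theorem eq_zero_of_forall_conj_abs_lt_one {K : Type*} [Field K] [CharZero K] [IsGalois ℚ K]
    (φ : K →+* ℝ) {x : K} (hx : IsIntegral ℤ x) (h : ∀ σ : K ≃ₐ[ℚ] K, |φ (σ x)| < 1) : x = 0 := by
  have hxQ : IsIntegral ℚ x := hx.tower_top
  have hm := minpoly.monic hxQ
  have hspl := Normal.splits (inferInstance : Normal ℚ K) x
  have hdeg : ((minpoly ℚ x).map (algebraMap ℚ K)).roots ≠ 0 := by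
    intro h0
    have h1 := hspl.natDegree_eq_card_roots
    rw [h0, Polynomial.natDegree_map] at h1
    exact (minpoly.natDegree_pos hxQ).ne' (by simpa using h1)
  have hprod := hspl.coeff_zero_eq_prod_roots_of_monic (hm.map _)
  have hint := minpoly.isIntegrallyClosed_eq_field_fractions' ℚ hx
  -- The constant coefficient is an integer and, up to sign, the product of conjugates of absolute
  -- value below one; hence it is 0.
  have hc : φ ((((minpoly ℤ x).coeff 0 : ℤ) : K)) =
      φ ((-1) ^ ((minpoly ℚ x).map (algebraMap ℚ K)).natDegree *
        ((minpoly ℚ x).map (algebraMap ℚ K)).roots.prod) := by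
    rw [← hprod, hint]; simp [Polynomial.coeff_map]
  have habs : |(((minpoly ℤ x).coeff 0 : ℤ) : ℝ)| < 1 := by
    rw [map_intCast, map_mul, map_multiset_prod] at hc
    rw [hc, abs_mul]
    have h1 : |φ ((-1) ^ ((minpoly ℚ x).map (algebraMap ℚ K)).natDegree)| = 1 := by simp
    rw [h1, one_mul]
    apply Multiset.abs_prod_lt_one
    · intro y hy
      obtain ⟨z, hz, rfl⟩ := Multiset.mem_map.1 hy
      obtain ⟨σ, rfl⟩ := minpoly.exists_algEquiv_of_root' (K := ℚ) (x := z) (y := x)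
        hxQ.isAlgebraic (by
          have := (Polynomial.mem_roots'.1 hz).2
          rwa [Polynomial.IsRoot.def, Polynomial.eval_map_algebraMap] at this)
      exact h σ
    · simpa using hdeg
  have h0 : (minpoly ℤ x).coeff 0 = 0 := by
    rw [← Int.cast_abs] at habs
    exact Int.abs_lt_one_iff.1 (by exact_mod_cast habs)
  have h0' : (minpoly ℚ x).coeff 0 = 0 := by rw [hint]; simp [Polynomial.coeff_map, h0]
  exact (minpoly.coeff_zero_eq_zero hxQ).1 h0'

theorem Rat.isIntegral_of_squarefree_mul_sq {m : ℕ} (hm : Squarefree m) {r : ℚ}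
    (h : IsIntegral ℤ ((m : ℚ) * r ^ 2)) : IsIntegral ℤ r := by
  obtain ⟨z, hz⟩ := IsIntegrallyClosed.isIntegral_iff.1 h
  have hden : (r.den : ℚ) ≠ 0 := by exact_mod_cast r.den_ne_zero
  have h1 : (m : ℤ) * r.num ^ 2 = z * (r.den : ℤ) ^ 2 := by
    have : (m : ℚ) * r.num ^ 2 = z * (r.den : ℚ) ^ 2 := by
      have h2 := Rat.mul_den_eq_num r
      rw [← h2, mul_pow, ← mul_assoc, ← hz]; simp
    exact_mod_cast this
  have h2 : ((r.den : ℤ)) ^ 2 ∣ (m : ℤ) := by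
    have hcop : IsCoprime ((r.den : ℤ) ^ 2) (r.num ^ 2) := by
      apply IsCoprime.pow
      rw [Int.isCoprime_iff_nat_coprime]
      simpa using r.reduced.symm
    exact hcop.dvd_of_dvd_mul_right ⟨z, by rw [h1]; ring⟩
  have h3 : r.den * r.den ∣ m := by
    rw [← pow_two]; exact_mod_cast h2
  have h4 : r.den = 1 := by simpa using hm _ h3
  rw [← Rat.coe_int_num_of_den_eq_one h4]
  exact isIntegral_algebraMap (R := ℤ) (x := r.num)

/-! ### Multiquadratic fields: independence of square roots and ramification. -/

section

variable {K : Type*} [Field K] [CharZero K] {s : ℕ → K}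

theorem IntermediateField.two_mem {k L : Type*} [Field k] [Field L] [Algebra k L]
    (E : IntermediateField k L) : (2 : L) ∈ E := by
  exact_mod_cast _root_.natCast_mem E 2

theorem exists_eq_add_mul_of_mem_adjoin_insert {q : ℕ} {F : Set ℕ} (hq : s q ^ 2 = (q : K)) {x : K}
    (hx : x ∈ adjoin ℚ (s '' insert q F)) :
    ∃ a ∈ adjoin ℚ (s '' F), ∃ b ∈ adjoin ℚ (s '' F), x = a + b * s q := by
  have hint : IsIntegral (adjoin ℚ (s '' F)) (s q) :=
    IsIntegral.of_pow (n := 2) two_pos (hq ▸ by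
      simpa using isIntegral_algebraMap (R := adjoin ℚ (s '' F)) (A := K) (x := (q : _)))
  rw [Set.image_insert_eq, Set.insert_eq, Set.union_comm, ← adjoin_adjoin_left,
    mem_restrictScalars, ← mem_toSubalgebra,
    adjoin_simple_toSubalgebra_of_isAlgebraic hint.isAlgebraic] at hx
  induction hx using Algebra.adjoin_induction with
  | mem y hy =>
    rw [Set.mem_singleton_iff] at hy
    exact ⟨0, zero_mem _, 1, one_mem _, by simp [hy]⟩
  | algebraMap r => exact ⟨r, r.2, 0, zero_mem _, by simp⟩
  | add x y _ _ hx hy =>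
    obtain ⟨a, ha, b, hb, rfl⟩ := hx
    obtain ⟨c, hc, d, hd, rfl⟩ := hy
    exact ⟨a + c, add_mem ha hc, b + d, add_mem hb hd, by ring⟩
  | mul x y _ _ hx hy =>
    obtain ⟨a, ha, b, hb, rfl⟩ := hx
    obtain ⟨c, hc, d, hd, rfl⟩ := hy
    refine ⟨a * c + b * d * q, add_mem (mul_mem ha hc)
      (mul_mem (mul_mem hb hd) (_root_.natCast_mem _ q)),
      a * d + b * c, add_mem (mul_mem ha hd) (mul_mem hb hc), ?_⟩
    rw [← hq]; ring

/-- Letting `m` be squarefree rather than prime makes the induction close: when x = b√q, the factor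
`q` is absorbed into `m`. -/
theorem eq_one_of_sq_eq_of_mem_adjoin (hs : ∀ q, q.Prime → s q ^ 2 = (q : K)) {F : Finset ℕ}
    (hF : ∀ q ∈ F, q.Prime) {m : ℕ} (hm : Squarefree m) (hmF : ∀ q ∈ F, m.Coprime q) {x : K}
    (hx : x ∈ adjoin ℚ (s '' F)) (hxm : x ^ 2 = (m : K)) : m = 1 := by
  classical
  induction F using Finset.induction_on generalizing m x with
  | empty =>
    simp only [Finset.coe_empty, Set.image_empty, adjoin_empty] at hx
    obtain ⟨r, rfl⟩ := mem_bot.1 hx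
    have h : r ^ 2 = (m : ℚ) := by
      apply (algebraMap ℚ K).injective; simpa using hxm
    have h1 : IsSquare (m : ℚ) := ⟨r, by rw [← h, pow_two]⟩
    obtain ⟨n, hn⟩ := Rat.isSquare_natCast_iff.1 h1
    have h2 : n = 1 := by simpa using hm n ⟨1, by rw [hn, mul_one]⟩
    rw [hn, h2]
  | insert q F hqF ih =>
    have hq := hF q (Finset.mem_insert_self q F)
    have hF' : ∀ p ∈ F, p.Prime := fun p hp => hF p (Finset.mem_insert_of_mem hp)
    have hmF' : ∀ p ∈ F, m.Coprime p := fun p hp => hmF p (Finset.mem_insert_of_mem hp)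
    have hmq : m.Coprime q := hmF q (Finset.mem_insert_self q F)
    have hqF' : ∀ p ∈ F, q.Coprime p := fun p hp =>
      (Nat.coprime_primes hq (hF' p hp)).2 (by rintro rfl; exact hqF hp)
    have hsq := hs q hq
    have hq0 : s q ≠ 0 := by
      intro h0; rw [h0] at hsq
      exact hq.ne_zero (by exact_mod_cast (by simpa using hsq.symm : (q : K) = 0))
    rw [Finset.coe_insert] at hx
    obtain ⟨a, ha, b, hb, rfl⟩ := exists_eq_add_mul_of_mem_adjoin_insert hsq hx
    by_cases hab : a * b = 0
    · rcases mul_eq_zero.1 hab with rfl | rfl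
      · have h1 := ih hF' (m := m * q)
          ((Nat.squarefree_mul hmq).2 ⟨hm, hq.squarefree⟩)
          (fun p hp => Nat.Coprime.mul_left (hmF' p hp) (hqF' p hp))
          (x := b * q) (mul_mem hb (_root_.natCast_mem _ q)) (by
            push_cast; rw [← hxm, ← hsq]; ring)
        exact absurd (Nat.eq_one_of_mul_eq_one_left h1) hq.ne_one
      · exact ih hF' hm hmF' ha (by simpa using hxm)
    -- Expanding (a + b√q)² = m with ab ≠ 0 solves for √q inside the smaller field.
    · exfalso
      have hsmem : s q ∈ adjoin ℚ (s '' F) := by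
        have h2 : s q = (m - a ^ 2 - b ^ 2 * q) / (2 * (a * b)) := by
          rw [eq_div_iff (mul_ne_zero two_ne_zero hab), ← hxm, ← hsq]; ring
        rw [h2]
        exact div_mem (sub_mem (sub_mem (_root_.natCast_mem _ m) (pow_mem ha 2))
          (mul_mem (pow_mem hb 2) (_root_.natCast_mem _ q)))
          (mul_mem (two_mem _) (mul_mem ha hb))
      exact hq.ne_one (ih hF' hq.squarefree hqF' hsmem hsq)

theorem exists_algEquiv_apply_eq_neg [IsGalois ℚ K] (hs : ∀ q, q.Prime → s q ^ 2 = (q : K))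
    {F : Finset ℕ} (hF : ∀ q ∈ F, q.Prime) {q : ℕ} (hq : q.Prime) (hqF : q ∉ F) :
    ∃ τ : K ≃ₐ[ℚ] K, τ (s q) = -s q ∧ ∀ x ∈ adjoin ℚ (s '' F), τ x = x := by
  have h1 : s q ∉ adjoin ℚ (s '' F) := fun h =>
    hq.ne_one (eq_one_of_sq_eq_of_mem_adjoin hs hF hq.squarefree (fun p hp =>
      (Nat.coprime_primes hq (hF p hp)).2 (by rintro rfl; exact hqF hp)) h (hs q hq))
  have h2 : ¬ ∀ f : K ≃ₐ[adjoin ℚ (s '' F)] K, f (s q) = s q := by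
    intro h
    -- `K` may have infinite degree; an element outside the subfield is still moved by some
    -- automorphism over it.
    obtain ⟨y, hy⟩ := (InfiniteGalois.mem_range_algebraMap_iff_fixed
      (k := adjoin ℚ (s '' F)) (K := K) (s q)).2 h
    exact h1 (hy ▸ y.2)
  push Not at h2
  obtain ⟨f, hf⟩ := h2
  refine ⟨f.restrictScalars ℚ, ?_, fun x hx => f.commutes ⟨x, hx⟩⟩
  have h3 : f (s q) ^ 2 = s q ^ 2 := by rw [← map_pow, hs q hq, map_natCast]
  exact (sq_eq_sq_iff_eq_or_eq_neg.1 h3).resolve_left hf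

/-- Each adjoined √q costs a factor 2: for x = a + b√q with conjugate x', both m(2a)² and mq(2b)²
are integral combinations of mx², mx'² and mxx'. -/
theorem isIntegral_two_pow_mul_of_mem_adjoin [IsGalois ℚ K]
    (hs : ∀ q, q.Prime → s q ^ 2 = (q : K)) {F : Finset ℕ}
    (hF : ∀ q ∈ F, q.Prime) {m : ℕ} (hm : Squarefree m) (hmF : ∀ q ∈ F, m.Coprime q) {x : K}
    (hx : x ∈ adjoin ℚ (s '' F)) (hxm : IsIntegral ℤ ((m : K) * x ^ 2)) :
    IsIntegral ℤ (2 ^ F.card * x) := by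
  classical
  induction F using Finset.induction_on generalizing m x with
  | empty =>
    simp only [Finset.coe_empty, Set.image_empty, adjoin_empty] at hx
    obtain ⟨r, rfl⟩ := mem_bot.1 hx
    have h : IsIntegral ℤ (algebraMap ℚ K ((m : ℚ) * r ^ 2)) := by simpa using hxm
    have h1 := Rat.isIntegral_of_squarefree_mul_sq hm
      ((isIntegral_algebraMap_iff (algebraMap ℚ K).injective).1 h)
    simpa using h1.algebraMap (B := K)
  | insert q F hqF ih =>
    have hq := hF q (Finset.mem_insert_self q F)
    have hF' : ∀ p ∈ F, p.Prime := fun p hp => hF p (Finset.mem_insert_of_mem hp)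
    have hmF' : ∀ p ∈ F, m.Coprime p := fun p hp => hmF p (Finset.mem_insert_of_mem hp)
    have hmq : m.Coprime q := hmF q (Finset.mem_insert_self q F)
    have hqF' : ∀ p ∈ F, q.Coprime p := fun p hp =>
      (Nat.coprime_primes hq (hF' p hp)).2 (by rintro rfl; exact hqF hp)
    have hsq := hs q hq
    obtain ⟨τ, hτ, hτF⟩ := exists_algEquiv_apply_eq_neg hs hF' hq hqF
    rw [Finset.coe_insert] at hx
    obtain ⟨a, ha, b, hb, rfl⟩ := exists_eq_add_mul_of_mem_adjoin_insert hsq hx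
    have hτx : IsIntegral ℤ ((m : K) * (a - b * s q) ^ 2) := by
      have := hxm.map (τ.toRingEquiv.toRingHom.toIntAlgHom)
      have h2 : τ ((m : K) * (a + b * s q) ^ 2) = (m : K) * (a - b * s q) ^ 2 := by
        simp [hτ, hτF a ha, hτF b hb, sub_eq_add_neg]
      rw [← h2]; exact this
    have hprod : IsIntegral ℤ ((m : K) * (a + b * s q) * (a - b * s q)) := by
      refine IsIntegral.of_pow (n := 2) two_pos ?_
      have e : ((m : K) * (a + b * s q) * (a - b * s q)) ^ 2 =
          m * (a + b * s q) ^ 2 * (m * (a - b * s q) ^ 2) := by ring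
      exact e ▸ hxm.mul hτx
    have h2 : IsIntegral ℤ (2 : K) := by simpa using isIntegral_algebraMap (R := ℤ) (A := K) (x := 2)
    have h2a := ih hF' hm hmF' (x := 2 * a)
      (mul_mem (two_mem _) ha) (by
      have e : (m : K) * (2 * a) ^ 2 = m * (a + b * s q) ^ 2 + m * (a - b * s q) ^ 2 +
          2 * (m * (a + b * s q) * (a - b * s q)) := by ring
      exact e ▸ (hxm.add hτx).add (h2.mul hprod))
    have h2b := ih hF' (m := m * q) ((Nat.squarefree_mul hmq).2 ⟨hm, hq.squarefree⟩)
      (fun p hp => Nat.Coprime.mul_left (hmF' p hp) (hqF' p hp))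
      (x := 2 * b) (mul_mem (two_mem _) hb) (by
        have e : ((m * q : ℕ) : K) * (2 * b) ^ 2 = m * (a + b * s q) ^ 2 + m * (a - b * s q) ^ 2 -
            2 * (m * (a + b * s q) * (a - b * s q)) := by push_cast; rw [← hsq]; ring
        exact e ▸ (hxm.add hτx).sub (h2.mul hprod))
    have hsint : IsIntegral ℤ (s q) := IsIntegral.of_pow (n := 2) two_pos (hsq ▸ by
      simpa using isIntegral_algebraMap (R := ℤ) (A := K) (x := (q : ℤ)))
    rw [Finset.card_insert_of_notMem hqF]
    have e : 2 ^ (F.card + 1) * (a + b * s q) =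
        2 ^ F.card * (2 * a) + 2 ^ F.card * (2 * b) * s q := by ring
    exact e ▸ h2a.add (h2b.mul hsint)

/-- An odd prime `p` is unramified in a field generated by square roots of other primes. -/
theorem isIntegral_of_prime_mul_sq [IsGalois ℚ K]
    (hs : ∀ q, q.Prime → s q ^ 2 = (q : K)) {F : Finset ℕ}
    (hF : ∀ q ∈ F, q.Prime) {p : ℕ} (hp : p.Prime) (hp2 : p ≠ 2) (hpF : p ∉ F) {x : K}
    (hx : x ∈ adjoin ℚ (s '' F)) (hxp : IsIntegral ℤ ((p : K) * x ^ 2)) :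
    IsIntegral ℤ x := by
  -- Both p·x² and a power of 2 times x² are integral; Bézout then makes x² integral.
  have h := isIntegral_two_pow_mul_of_mem_adjoin hs hF hp.squarefree (fun q hq =>
      (Nat.coprime_primes hp (hF q hq)).2 (by rintro rfl; exact hpF hq)) hx hxp
  have hcop : IsCoprime (p : ℤ) ((2 ^ F.card) ^ 2 : ℤ) := by
    have : Nat.Coprime p ((2 ^ F.card) ^ 2) :=
      (((Nat.coprime_primes hp Nat.prime_two).2 hp2).pow_right _).pow_right _
    exact_mod_cast Nat.isCoprime_iff_coprime.2 this
  obtain ⟨u, v, huv⟩ := hcop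
  have hZ : ∀ z : ℤ, IsIntegral ℤ (z : K) := fun z => by
    simpa using isIntegral_algebraMap (R := ℤ) (A := K) (x := z)
  refine IsIntegral.of_pow (n := 2) two_pos ?_
  have huv' : (u : K) * p + v * (2 ^ F.card) ^ 2 = 1 := by
    exact_mod_cast congrArg (Int.cast (R := K)) huv
  have h1 : x ^ 2 = u * (p * x ^ 2) + v * (2 ^ F.card * x) ^ 2 := by
    linear_combination (-x ^ 2) * huv'
  rw [h1]
  exact ((hZ u).mul hxp).add ((hZ v).mul (h.pow 2))

end

theorem Finset.eq_zero_of_ne_of_sum_sq_lt_two {ι : Type*} {J : Finset ι} {y : ι → ℝ}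
    (hy : ∀ j ∈ J, y j = 0 ∨ y j ^ 2 = 1) (h : ∑ j ∈ J, y j ^ 2 < 2) {i : ι} (hi : i ∈ J)
    (hi0 : y i ≠ 0) : ∀ j ∈ J, j ≠ i → y j = 0 := by
  classical
  intro j hj hji
  by_contra hj0
  have h1 : ∑ k ∈ {i, j}, y k ^ 2 ≤ ∑ k ∈ J, y k ^ 2 :=
    Finset.sum_le_sum_of_subset_of_nonneg (by simp [Finset.insert_subset_iff, hi, hj])
      (fun _ _ _ => sq_nonneg _)
  rw [Finset.sum_pair hji.symm, (hy i hi).resolve_left hi0, (hy j hj).resolve_left hj0] at h1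
  linarith

/-! ### Splitting off the largest prime, and the lower bound on the number of squares. -/

section

variable {K : Type*} [Field K] [CharZero K] {s : ℕ → K}

theorem conj_half_one_add_sqrt_sq_le (hs : ∀ q, q.Prime → s q ^ 2 = (q : K)) (φ : K →+* ℝ)
    {q : ℕ} (hq : q.Prime) : φ (((1 + s q) / 2) ^ 2) ≤ q := by
  have h1 : φ (s q) ^ 2 = q := by rw [← map_pow, hs q hq, map_natCast]
  have h2 : (1 : ℝ) ≤ q := by exact_mod_cast hq.one_le
  simp only [map_pow, map_div₀, map_add, map_one, map_ofNat]
  nlinarith [sq_nonneg (φ (s q) - 1)]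

variable [IsGalois ℚ K]

theorem exists_sq_eq_of_sum_sq_eq (φ : K →+* ℝ) (hs : ∀ q, q.Prime → s q ^ 2 = (q : K))
    (hgen : ∀ x : K, ∃ F : Finset ℕ, (∀ q ∈ F, q.Prime) ∧ x ∈ adjoin ℚ (s '' F))
    {p : ℕ} (hp : p.Prime) (hp2 : p ≠ 2) {T : Finset ℕ} (hT : ∀ q ∈ T, q.Prime)
    (hTp : 1 + 4 * ∑ q ∈ T, q < p) {ι : Type*} {J : Finset ι} {Y : ι → K}
    (hY : ∀ j ∈ J, IsIntegral ℤ (Y j))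
    (h : ∑ j ∈ J, Y j ^ 2 = ((1 + s p) / 2) ^ 2 + ∑ q ∈ T, ((1 + s q) / 2) ^ 2) :
    ∃ j ∈ J, Y j ^ 2 = ((1 + s p) / 2) ^ 2 := by
  classical
  choose G hG hGY using fun j => hgen (Y j)
  have hpT : p ∉ T := fun hpT => by
    have := Finset.single_le_sum (f := fun q : ℕ => q) (fun _ _ => Nat.zero_le _) hpT
    omega
  -- `F` holds every prime needed for the `Y j` and for `T`, except `p`; so τ flips √p and fixes all
  -- else.
  set F := (J.biUnion G ∪ T).erase p with hFdef
  have hF : ∀ q ∈ F, q.Prime := by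
    intro q hq
    rw [hFdef, Finset.mem_erase, Finset.mem_union, Finset.mem_biUnion] at hq
    rcases hq.2 with ⟨j, -, hj⟩ | hq
    · exact hG j q hj
    · exact hT q hq
  have hpF : p ∉ F := Finset.notMem_erase p _
  obtain ⟨τ, hτ, hτF⟩ := exists_algEquiv_apply_eq_neg hs hF hp hpF
  have hsp := hs p hp
  have hsp0 : s p ≠ 0 := by
    intro h0; rw [h0] at hsp
    exact hp.ne_zero (by exact_mod_cast (by simpa using hsp.symm : (p : K) = 0))
  have hdec : ∀ j, ∃ a b : K, j ∈ J → a ∈ adjoin ℚ (s '' F) ∧ b ∈ adjoin ℚ (s '' F) ∧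
      Y j = a + b * s p := by
    intro j
    by_cases hj : j ∈ J
    · have hmem : Y j ∈ adjoin ℚ (s '' insert p (F : Set ℕ)) := by
        refine adjoin.mono ℚ _ _ (Set.image_mono ?_) (hGY j)
        intro q hq
        by_cases hqp : q = p
        · exact Or.inl hqp
        · refine Or.inr (Finset.mem_coe.2 (Finset.mem_erase.2 ⟨hqp, Finset.mem_union_left _ ?_⟩))
          exact Finset.mem_biUnion.2 ⟨j, hj, hq⟩
      obtain ⟨a, ha, b, hb, hab⟩ := exists_eq_add_mul_of_mem_adjoin_insert hsp hmem
      exact ⟨a, b, fun _ => ⟨ha, hb, hab⟩⟩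
    · exact ⟨0, 0, fun h => absurd h hj⟩
  choose a b hab using hdec
  have hτY : ∀ j ∈ J, τ (Y j) = a j - b j * s p := by
    intro j hj
    obtain ⟨ha, hb, e⟩ := hab j hj
    rw [e, map_add, map_mul, hτ, hτF _ ha, hτF _ hb]; ring
  have hτT : ∀ q ∈ T, τ (s q) = s q := fun q hq => hτF _ (subset_adjoin ℚ _
    ⟨q, Finset.mem_coe.2 (Finset.mem_erase.2 ⟨by rintro rfl; exact hpT hq,
      Finset.mem_union_right _ hq⟩), rfl⟩)
  have hτh : ∑ j ∈ J, (a j - b j * s p) ^ 2 =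
      ((1 - s p) / 2) ^ 2 + ∑ q ∈ T, ((1 + s q) / 2) ^ 2 := by
    have h1 := congrArg τ h
    rw [map_sum, map_add, map_sum] at h1
    rw [Finset.sum_congr rfl (fun j hj => by rw [map_pow, hτY j hj]),
      Finset.sum_congr (s₁ := T) rfl (fun q hq => by
        rw [map_pow, map_div₀, map_add, hτT q hq, map_one, map_ofNat])] at h1
    rw [h1]; simp [hτ, sub_eq_add_neg, map_ofNat τ 2]
  have hh : ∑ j ∈ J, (a j + b j * s p) ^ 2 =
      ((1 + s p) / 2) ^ 2 + ∑ q ∈ T, ((1 + s q) / 2) ^ 2 := by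
    rw [← h]; exact Finset.sum_congr rfl (fun j hj => by rw [(hab j hj).2.2])
  have hbint : ∀ j ∈ J, IsIntegral ℤ (2 * b j) := by
    intro j hj
    refine isIntegral_of_prime_mul_sq hs hF hp hp2 hpF
      (mul_mem (two_mem _)
        (hab j hj).2.1) ?_
    have e : (p : K) * (2 * b j) ^ 2 = (Y j - τ (Y j)) ^ 2 := by
      rw [hτY j hj, (hab j hj).2.2, ← hsp]; ring
    rw [e]
    exact ((hY j hj).sub ((hY j hj).map τ.toRingEquiv.toRingHom.toIntAlgHom)).pow 2
  have hpar : (p : K) * ∑ j ∈ J, (2 * b j) ^ 2 + ∑ j ∈ J, (2 * a j) ^ 2 =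
      1 + p + 4 * ∑ q ∈ T, ((1 + s q) / 2) ^ 2 := by
    have e : (p : K) * ∑ j ∈ J, (2 * b j) ^ 2 + ∑ j ∈ J, (2 * a j) ^ 2 =
        2 * ∑ j ∈ J, (a j + b j * s p) ^ 2 + 2 * ∑ j ∈ J, (a j - b j * s p) ^ 2 := by
      simp only [Finset.mul_sum, ← Finset.sum_add_distrib]
      exact Finset.sum_congr rfl (fun j _ => by rw [← hsp]; ring)
    rw [e, hh, hτh, ← hsp]; ring
  have hlt : ∀ σ : K ≃ₐ[ℚ] K, ∑ j ∈ J, (φ (σ (2 * b j))) ^ 2 < 2 := by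
    intro σ
    have h1 := congrArg (fun x => φ (σ x)) hpar
    simp only [map_add, map_mul (f := σ), map_mul (f := φ), map_natCast, map_sum, map_pow,
      map_one, map_ofNat] at h1
    have hT' : ∑ q ∈ T, φ (σ ((1 + s q) / 2)) ^ 2 ≤ ∑ q ∈ T, (q : ℝ) :=
      Finset.sum_le_sum fun q hq => by
        simpa using conj_half_one_add_sqrt_sq_le hs (φ.comp (σ : K →+* K)) (hT q hq)
    have hnn : 0 ≤ ∑ j ∈ J, (2 * φ (σ (a j))) ^ 2 := Finset.sum_nonneg fun _ _ => sq_nonneg _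
    have hTp' : (1 : ℝ) + 4 * ∑ q ∈ T, (q : ℝ) < p := by
      have h2 := (Nat.cast_lt (α := ℝ)).2 hTp
      push_cast at h2; exact h2
    have hp0 : (0 : ℝ) < p := by exact_mod_cast hp.pos
    simp only [map_mul, map_ofNat]
    by_contra! hge
    nlinarith
  have hb01 : ∀ j ∈ J, 2 * b j = 0 ∨ (2 * b j) ^ 2 = 1 := by
    intro j hj
    by_cases h0 : 2 * b j = 0
    · exact Or.inl h0
    · right
      rw [← sub_eq_zero]
      refine eq_zero_of_forall_conj_abs_lt_one φ (((hbint j hj).pow 2).sub isIntegral_one) ?_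
      intro σ
      have h1 := (Finset.single_le_sum (f := fun j => (φ (σ (2 * b j))) ^ 2)
        -- Every conjugate of (2b)² lies strictly between 0 and 2, so (2b)² - 1 vanishes.
        (fun _ _ => sq_nonneg _) hj).trans_lt (hlt σ)
      have h2 : 0 < (φ (σ (2 * b j))) ^ 2 := by
        refine sq_pos_of_ne_zero ?_
        rw [map_ne_zero, map_ne_zero]; exact h0
      rw [map_sub, map_sub, map_pow, map_pow, map_one, map_one, abs_lt]
      constructor <;> linarith
  -- Difference of the two conjugate identities, divided by √p.
  have hcross : ∑ j ∈ J, (2 * b j) * (2 * a j) = 1 := by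
    have e : s p * ∑ j ∈ J, (2 * b j) * (2 * a j) =
        ∑ j ∈ J, (a j + b j * s p) ^ 2 - ∑ j ∈ J, (a j - b j * s p) ^ 2 := by
      rw [Finset.mul_sum, ← Finset.sum_sub_distrib]
      exact Finset.sum_congr rfl (fun j _ => by ring)
    rw [hh, hτh] at e
    apply mul_left_cancel₀ hsp0
    rw [e]; ring
  obtain ⟨i, hi, hi0⟩ : ∃ i ∈ J, 2 * b i ≠ 0 := by
    by_contra! hall
    rw [Finset.sum_eq_zero (fun j hj => by rw [hall j hj, zero_mul])] at hcross
    exact zero_ne_one hcross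
  have hother : ∀ j ∈ J, j ≠ i → 2 * b j = 0 := by
    have h1 := Finset.eq_zero_of_ne_of_sum_sq_lt_two (J := J) (y := fun j => φ (2 * b j))
      (fun j hj => (hb01 j hj).imp (fun e => by simp only [e, map_zero])
        (fun e => by simp only [← map_pow, e, map_one]))
      (by simpa using hlt AlgEquiv.refl) hi (by rw [map_ne_zero]; exact hi0)
    exact fun j hj hji => (map_eq_zero φ).1 (h1 j hj hji)
  refine ⟨i, hi, ?_⟩
  rw [Finset.sum_eq_single_of_mem i hi (fun j hj hji => by rw [hother j hj hji, zero_mul])]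
    at hcross
  have hbi := (hb01 i hi).resolve_left hi0
  have hai : a i = b i := by
    apply mul_left_cancel₀ (mul_ne_zero two_ne_zero hi0)
    linear_combination hcross - hbi
  rw [(hab i hi).2.2, hai]
  linear_combination ((1 + s p) ^ 2 / 4) * hbi

theorem exists_finset_forall_sum_sq_eq_imp_le_card (φ : K →+* ℝ)
    (hs : ∀ q, q.Prime → s q ^ 2 = (q : K))
    (hgen : ∀ x : K, ∃ F : Finset ℕ, (∀ q ∈ F, q.Prime) ∧ x ∈ adjoin ℚ (s '' F))
    {P : Set ℕ} (hP : P.Infinite) (hPp : ∀ p ∈ P, p.Prime) (n : ℕ) :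
    ∃ T : Finset ℕ, ↑T ⊆ P ∧ T.card = n ∧ ∀ (J : Finset ℕ) (Y : ℕ → K),
      (∀ j ∈ J, IsIntegral ℤ (Y j)) → ∑ j ∈ J, Y j ^ 2 = ∑ q ∈ T, ((1 + s q) / 2) ^ 2 →
        n ≤ J.card := by
  classical
  induction n with
  | zero => exact ⟨∅, by simp, by simp, fun _ _ _ _ => Nat.zero_le _⟩
  | succ n ih =>
    obtain ⟨T, hTP, hTn, hT⟩ := ih
    -- The constant 2, instead of 1, also excludes p = 2 when `T` is empty.
    obtain ⟨p, hpP, hp⟩ := hP.exists_gt (2 + 4 * ∑ q ∈ T, q)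
    have hpT : p ∉ T := fun hpT => by
      have := Finset.single_le_sum (f := fun q : ℕ => q) (fun _ _ => Nat.zero_le _) hpT
      omega
    refine ⟨insert p T, ?_, by rw [Finset.card_insert_of_notMem hpT, hTn], ?_⟩
    · rw [Finset.coe_insert]; exact Set.insert_subset hpP hTP
    · intro J Y hY h
      rw [Finset.sum_insert hpT] at h
      obtain ⟨i, hi, hiY⟩ := exists_sq_eq_of_sum_sq_eq φ hs hgen (hPp p hpP) (by omega)
        (fun q hq => hPp q (hTP hq)) (by omega) hY h
      rw [← Finset.add_sum_erase J _ hi, hiY] at h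
      have h1 := hT (J.erase i) Y (fun j hj => hY j (Finset.mem_of_mem_erase hj))
        (add_left_cancel h)
      rw [← Finset.card_erase_add_one hi]
      omega

end

/-! ### The ambient Galois field inside ℝ. -/

/-- The compositum inside `ℝ` of the fields `ℚ(√q)` for `q` prime. -/
noncomputable def primeSqrtField : IntermediateField ℚ ℝ :=
  adjoin ℚ ((fun q : ℕ => √(q : ℝ)) '' {q | q.Prime})

theorem sqrt_natCast_mem_primeSqrtField (n : ℕ) : √(n : ℝ) ∈ primeSqrtField := by
  induction n using Nat.recOnMul with
  | zero => simp
  | one => simp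
  | prime q hq => exact subset_adjoin ℚ _ ⟨q, hq, rfl⟩
  | mul a b ha hb =>
    rw [Nat.cast_mul, Real.sqrt_mul (Nat.cast_nonneg a)]
    exact mul_mem ha hb

theorem sqrt_ratCast_mem_primeSqrtField (r : ℚ) : √(r : ℝ) ∈ primeSqrtField := by
  rcases lt_or_ge r 0 with hr | hr
  · rw [Real.sqrt_eq_zero_of_nonpos (by exact_mod_cast hr.le)]; exact zero_mem _
  · have h1 : (r : ℝ) = (r.num.toNat : ℝ) / (r.den : ℝ) := by
      have h2 : ((r.num.toNat : ℤ) : ℝ) = (r.num : ℝ) := by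
        rw [Int.toNat_of_nonneg (Rat.num_nonneg.2 hr)]
      rw [Int.cast_natCast] at h2
      rw [h2]; exact Rat.cast_def r
    rw [h1, Real.sqrt_div (Nat.cast_nonneg _)]
    exact div_mem (sqrt_natCast_mem_primeSqrtField _) (sqrt_natCast_mem_primeSqrtField _)

theorem mem_primeSqrtField_of_quadratic {x : ℝ} {b c : ℚ} (h : x ^ 2 + b * x + c = 0) :
    x ∈ primeSqrtField := by
  have h1 : (2 * x + b) ^ 2 = ((b ^ 2 - 4 * c : ℚ) : ℝ) := by
    push_cast; linear_combination 4 * h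
  have h2 : |2 * x + b| ∈ primeSqrtField := by
    rw [← Real.sqrt_sq_eq_abs, h1]; exact sqrt_ratCast_mem_primeSqrtField _
  have h3 : 2 * x + b ∈ primeSqrtField := by
    rcases abs_choice (2 * x + (b : ℝ)) with e | e
    · rwa [← e]
    · rw [e] at h2; simpa using neg_mem h2
  have hb : (b : ℝ) ∈ primeSqrtField := primeSqrtField.algebraMap_mem b
  have e : x = ((2 * x + b) - b) / 2 := by ring
  rw [e]
  exact div_mem (sub_mem h3 hb) (two_mem primeSqrtField)

noncomputable instance : IsGalois ℚ primeSqrtField where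
  to_isSeparable := by
    have h : Algebra.IsAlgebraic ℚ primeSqrtField := by
      refine isAlgebraic_adjoin ?_
      rintro _ ⟨q, -, rfl⟩
      exact IsIntegral.of_pow (n := 2) two_pos (by
        simpa using isIntegral_algebraMap (R := ℚ) (A := ℝ) (x := q))
    infer_instance
  to_normal := by
    have hspl : ∀ y ∈ ((fun q : ℕ => √(q : ℝ)) '' {q | q.Prime}), IsIntegral ℚ y ∧
        ((minpoly ℚ y).map (algebraMap ℚ primeSqrtField)).Splits := by
      rintro _ ⟨q, -, rfl⟩
      have hq : √(q : ℝ) ^ 2 = q := Real.sq_sqrt (Nat.cast_nonneg q)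
      let P : Polynomial ℚ := Polynomial.X ^ 2 - Polynomial.C (q : ℚ)
      have hroot : Polynomial.aeval √(q : ℝ) P = 0 := by simp [P, hq]
      have hmonic : P.Monic := Polynomial.monic_X_pow_sub_C _ two_ne_zero
      refine ⟨⟨P, hmonic, hroot⟩, ?_⟩
      have hdvd := Polynomial.map_dvd (algebraMap ℚ primeSqrtField) (minpoly.dvd ℚ _ hroot)
      refine Polynomial.Splits.of_dvd ?_ (hmonic.map _).ne_zero hdvd
      let t : primeSqrtField := ⟨√(q : ℝ), sqrt_natCast_mem_primeSqrtField q⟩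
      have ht : t ^ 2 = (q : primeSqrtField) := Subtype.ext (by simp [t])
      have e : P.map (algebraMap ℚ primeSqrtField) =
          (Polynomial.X - Polynomial.C t) * (Polynomial.X + Polynomial.C t) := by
        rw [Polynomial.map_sub, Polynomial.map_pow, Polynomial.map_X, Polynomial.map_C,
          map_natCast, ← ht, map_pow]; ring
      rw [e]
      exact (Polynomial.Splits.X_sub_C t).mul (Polynomial.Splits.X_add_C t)
    refine normal_iff.2 fun x => ?_
    have hx : IsIntegral ℚ x := (isIntegral_algebraMap_iff
      (algebraMap primeSqrtField ℝ).injective).1 (by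
        have : Algebra.IsIntegral ℚ primeSqrtField :=
          (isAlgebraic_adjoin fun y hy => (hspl y hy).1).isIntegral
        exact (Algebra.IsIntegral.isIntegral x).algebraMap)
    refine ⟨hx, ?_⟩
    have h1 := splits_of_mem_adjoin _ _ hspl x.2
    have h2 := minpoly.algebraMap_eq (A := ℚ) (algebraMap primeSqrtField ℝ).injective x
    rw [← h2]; exact h1

theorem exists_finset_mem_adjoin_primeSqrtField {s : ℕ → primeSqrtField}
    (hs : ∀ q, (s q : ℝ) = √(q : ℝ)) (x : primeSqrtField) :
    ∃ F : Finset ℕ, (∀ q ∈ F, q.Prime) ∧ x ∈ adjoin ℚ (s '' F) := by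
  classical
  obtain ⟨U, hU, hxU⟩ := exists_finset_of_mem_adjoin x.2
  obtain ⟨F, hF, rfl⟩ := Finset.subset_set_image_iff.1 hU
  refine ⟨F, fun q hq => hF hq, ?_⟩
  have e : (adjoin ℚ (s '' F)).map (algebraMap primeSqrtField ℝ).toRatAlgHom =
      adjoin ℚ (((F.image fun q : ℕ => √(q : ℝ)) : Finset ℝ) : Set ℝ) := by
    rw [adjoin_map, Finset.coe_image, Set.image_image]
    congr 1
    exact Set.image_congr fun q _ => hs q
  rw [← e] at hxU
  obtain ⟨y, hy, hyx⟩ := hxU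
  have : y = x := Subtype.ext hyx
  exact this ▸ hy

theorem isIntegral_half_one_add {R : Type*} [Field R] [CharZero R] {t : R} {p : ℕ}
    (hp : p ≡ 1 [MOD 4]) (ht : t ^ 2 = p) : IsIntegral ℤ ((1 + t) / 2) := by
  obtain ⟨k, hk⟩ : ∃ k : ℤ, (p : ℤ) = 1 + 4 * k := by
    have h1 : p % 4 = 1 := hp
    exact ⟨(p / 4 : ℕ), by omega⟩
  have hk' : (p : R) = 1 + 4 * k := by exact_mod_cast congrArg (Int.cast (R := R)) hk
  refine ⟨Polynomial.X ^ 2 - Polynomial.X - Polynomial.C k, by monicity!, ?_⟩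
  rw [Polynomial.eval₂_sub, Polynomial.eval₂_sub, Polynomial.eval₂_pow, Polynomial.eval₂_X,
    Polynomial.eval₂_C, eq_intCast]
  linear_combination ht / 4 + hk' / 4

/-! ### Descent to subfields and the two cases of the theorem. -/

/-- The lower bound holds in the large field, so it passes to any subfield containing the ω_q; `M`
need not contain the root of every prime involved. -/
theorem pythagorasNumber_eq_top_of_le_primeSqrtField {M : IntermediateField ℚ ℝ}
    (hM : M ≤ primeSqrtField)
    (hinf : {p : ℕ | √(p : ℝ) ∈ M ∧ p.Prime ∧ p ≡ 1 [MOD 4]}.Infinite) :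
    pythagorasNumber (NumberField.RingOfIntegers M) = ⊤ := by
  simp only [pythagorasNumber, iInf_eq_top]
  rintro n ⟨-, hn⟩
  exfalso
  let s : ℕ → primeSqrtField := fun q => ⟨√(q : ℝ), sqrt_natCast_mem_primeSqrtField q⟩
  obtain ⟨T, hTP, hTn, hT⟩ := exists_finset_forall_sum_sq_eq_imp_le_card (s := s)
    (algebraMap primeSqrtField ℝ)
    (fun q _ => Subtype.ext (by simp [s]))
    (exists_finset_mem_adjoin_primeSqrtField fun _ => rfl) hinf (fun p hp => hp.2.1) (n + 1)
  have hω : ∀ q : ℕ, ∃ w : NumberField.RingOfIntegers M, q ∈ T →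
      ((w : M) : ℝ) = (1 + √(q : ℝ)) / 2 := by
    intro q
    by_cases hq : q ∈ T
    · obtain ⟨hqM, -, hq4⟩ := hTP hq
      let t : M := ⟨√(q : ℝ), hqM⟩
      have ht : t ^ 2 = (q : M) := Subtype.ext (by simp [t])
      exact ⟨⟨(1 + t) / 2, isIntegral_half_one_add hq4 ht⟩, fun _ => by
        change (((1 + t) / 2 : M) : ℝ) = _
        push_cast; rfl⟩
    · exact ⟨0, fun h => absurd h hq⟩
  choose w hw using hω
  have hmem : ∑ q ∈ T, w q ^ 2 ∈ sumsOfSquares (NumberField.RingOfIntegers M) (n + 1) := by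
    refine ⟨fun i => w ((T.equivFin.trans (finCongr hTn)).symm i), ?_⟩
    rw [Equiv.sum_comp (T.equivFin.trans (finCongr hTn)).symm (fun q : T => w q ^ 2),
      ← Finset.sum_coe_sort]
  rw [← hn] at hmem
  obtain ⟨x, hx⟩ := hmem
  let ψ : NumberField.RingOfIntegers M →+* primeSqrtField :=
    ((inclusion hM : M →+* primeSqrtField)).comp (algebraMap (NumberField.RingOfIntegers M) M)
  have hψ : ∀ z, ((ψ z : primeSqrtField) : ℝ) = ((z : M) : ℝ) := fun z => rfl
  -- The value 0 beyond `n` only extends the family to ℕ and never enters the sum.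
  have key := hT (Finset.range n) (fun j => if h : j < n then ψ (x ⟨j, h⟩) else 0)
    (fun j hj => by
      rw [dif_pos (Finset.mem_range.1 hj)]
      exact (NumberField.RingOfIntegers.isIntegral (x _)).map ψ.toIntAlgHom) (by
      rw [Finset.sum_range]
      simp only [Fin.is_lt, dif_pos, Fin.eta]
      rw [← Finset.sum_congr rfl fun i _ => map_pow ψ (x i) 2, ← map_sum, ← hx, map_sum]
      refine Finset.sum_congr rfl fun q hq => ?_
      rw [map_pow]
      congr 1
      exact Subtype.ext (by rw [hψ, hw q hq]; push_cast; rfl))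
  rw [Finset.card_range] at key
  omega

theorem realMultiquadraticField_le_primeSqrtField (S : Set ℕ) :
    realMultiquadraticField S ≤ primeSqrtField := by
  rw [realMultiquadraticField, adjoin_le_iff]
  rintro _ ⟨n, -, rfl⟩
  exact sqrt_natCast_mem_primeSqrtField n

theorem compositumRealQuadratic_le_primeSqrtField :
    compositumRealQuadratic ≤ primeSqrtField := by
  refine iSup₂_le fun F hF x hx => ?_
  have : FiniteDimensional ℚ F := Module.finite_of_finrank_eq_succ hF
  let y : F := ⟨x, hx⟩
  have hy : IsIntegral ℚ y := Algebra.IsIntegral.isIntegral y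
  have hdvd : (minpoly ℚ y).natDegree ∣ 2 := hF ▸ minpoly.degree_dvd hy
  have hroot : Polynomial.aeval x (minpoly ℚ y) = 0 := by
    have := congrArg (algebraMap F ℝ) (minpoly.aeval ℚ y)
    rwa [map_zero, ← Polynomial.aeval_algebraMap_apply] at this
  have hlead := (minpoly.monic hy).coeff_natDegree
  rw [Polynomial.aeval_eq_sum_range] at hroot
  rcases (Nat.dvd_prime Nat.prime_two).1 hdvd with h1 | h1
  · rw [h1] at hroot hlead
    simp only [Finset.sum_range_succ, Finset.sum_range_zero, hlead, Rat.smul_def] at hroot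
    have e : x = ((-(minpoly ℚ y).coeff 0 : ℚ) : ℝ) := by
      push_cast at hroot ⊢; linarith
    rw [e]; exact primeSqrtField.algebraMap_mem _
  · rw [h1] at hroot hlead
    simp only [Finset.sum_range_succ, Finset.sum_range_zero, hlead, Rat.smul_def] at hroot
    refine mem_primeSqrtField_of_quadratic (b := (minpoly ℚ y).coeff 1)
      (c := (minpoly ℚ y).coeff 0) ?_
    push_cast at hroot
    linarith

theorem sqrt_prime_mem_compositumRealQuadratic {p : ℕ} (hp : p.Prime) :
    √(p : ℝ) ∈ compositumRealQuadratic := by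
  have hq : √(p : ℝ) ^ 2 = p := Real.sq_sqrt (Nat.cast_nonneg p)
  let P : Polynomial ℚ := Polynomial.X ^ 2 - Polynomial.C (p : ℚ)
  have hroot : Polynomial.aeval √(p : ℝ) P = 0 := by simp [P, hq]
  have hmonic : P.Monic := Polynomial.monic_X_pow_sub_C _ two_ne_zero
  have hint : IsIntegral ℚ √(p : ℝ) := ⟨P, hmonic, hroot⟩
  have hdeg : (minpoly ℚ √(p : ℝ)).natDegree = 2 := by
    refine le_antisymm ?_ ((minpoly.two_le_natDegree_iff hint).2 ?_)
    · have := Polynomial.natDegree_le_of_dvd (minpoly.dvd ℚ _ hroot) hmonic.ne_zero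
      rwa [Polynomial.natDegree_X_pow_sub_C] at this
    · rintro ⟨r, hr⟩
      exact hp.irrational_sqrt ⟨r, by simpa using hr⟩
  have hfin : Module.finrank ℚ ℚ⟮√(p : ℝ)⟯ = 2 := by rw [adjoin.finrank hint, hdeg]
  exact (le_iSup₂_of_le (f := fun (F : IntermediateField ℚ ℝ) (_ : Module.finrank ℚ F = 2) => F)
    ℚ⟮√(p : ℝ)⟯ hfin le_rfl) (mem_adjoin_simple_self ℚ _)

theorem theorem1p1 :
    (∀ S : Set ℕ, {p : ℕ | p ∈ S ∧ p.Prime ∧ p ≡ 1 [MOD 4]}.Infinite →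
      pythagorasNumber (NumberField.RingOfIntegers (realMultiquadraticField S)) = ⊤) ∧
    pythagorasNumber (NumberField.RingOfIntegers compositumRealQuadratic) = ⊤ := by
  constructor
  · intro S hS
    refine pythagorasNumber_eq_top_of_le_primeSqrtField
      (realMultiquadraticField_le_primeSqrtField S) (hS.mono ?_)
    rintro p ⟨hpS, hp⟩
    exact ⟨subset_adjoin ℚ _ ⟨p, hpS, rfl⟩, hp⟩
  · refine pythagorasNumber_eq_top_of_le_primeSqrtField
      compositumRealQuadratic_le_primeSqrtField
      ((Nat.infinite_setOfPred_prime_modEq_one (k := 4) (by norm_num)).mono ?_)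
    rintro p ⟨hp, hp4⟩
    exact ⟨sqrt_prime_mem_compositumRealQuadratic hp, hp, hp4⟩
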